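/- Let $C$ be a closed convex subset of a real normed space $(X,\|\cdot\|)$ (for instance a Banach space), let $T:C\to C$ be nonexpansive (that is, $\|Tu-Tv\|\le\|u-v\|$ for all $u,v\in C$), let $(\alpha_n)_{n\ge 1}$ be a sequence in $[0,1]$ and $(e_n)_{n\ge 1}$ a sequence in $X$. Let $(x_n)_{n\ge 0}$ satisfy $$x_{n+1}=(1-\alpha_{n+1})\,x_n+\alpha_{n+1}\,(Tx_n+e_{n+1})\qquad (n\ge 0),$$ and assume $(H_0)$ there exists $\kappa\in[0,\infty)$ such that $x_n\in C$ and $\|Tx_n-x_0\|\le\kappa$ for all $n\ge 0$. Put $\tau_n=\sum_{k=1}^n\alpha_k(1-\alpha_k)$ and let $a\in\mathbb{R}$. All $O(\cdot)$ are as $n\to\infty$. 1. Suppose that $\tau_n\to\infty$ and $\|e_n\|=O\big((1-\alpha_n)/\tau_n^a\big)$. (a) If $\frac12\le a<1$, then $\|x_n-Tx_n\|=O\big(1/\tau_n^{a-1/2}\big)$. (b) If $a=1$, then $\|x_n-Tx_n\|=O\big(\log\tau_n/\sqrt{\tau_n}\big)$. (c) If $a>1$, then $\|x_n-Tx_n\|=O\big(1/\sqrt{\tau_n}\big)$.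 2. Suppose that $\alpha_n$ is bounded away from $0$ and $1$ (there is $\delta>0$ with $\delta\le\alpha_n\le 1-\delta$ for all $n\ge 1$) and $\|e_n\|=O(1/n^a)$. (a) If $\frac12\le a<1$, then $\|x_n-Tx_n\|=O\big(1/n^{a-1/2}\big)$. (b) If $a=1$, then $\|x_n-Tx_n\|=O\big(\log n/\sqrt{n}\big)$. (c) If $a>1$, then $\|x_n-Tx_n\|=O\big(1/\sqrt{n}\big)$. 3. Suppose that $\alpha_n=1/n$ for all $n\ge 1$ and $\|e_n\|=O(1/\log^a n)$. (a) If $\frac12\le a<1$, then $\|x_n-Tx_n\|=O\big(1/\log^{a-1/2}n\big)$. (b) If $a=1$, then $\|x_n-Tx_n\|=O\big(\log\log n/\sqrt{\log n}\big)$. (c) If $a>1$, then $\|x_n-Tx_n\|=O\big(1/\sqrt{\log n}\big)$. -/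

import Mathlib

open Filter Asymptotics Topology

/-- The partial sums `τ n = ∑_{k=1}^n α k * (1 - α k)`; the value `α 0` plays no role. -/
noncomputable def stepSum (α : ℕ → ℝ) (n : ℕ) : ℝ :=
  ∑ k ∈ Finset.Icc 1 n, α k * (1 - α k)

/-- `x` is generated from `x 0` by the inexact Krasnosel'skii-Mann iteration
`x (n+1) = (1 - α (n+1)) x n + α (n+1) (T (x n) + e (n+1))`; `α 0` and `e 0` play no role. -/
def IsInexactKM {X : Type*} [NormedAddCommGroup X] [NormedSpace ℝ X]
    (T : X → X) (α : ℕ → ℝ) (e x : ℕ → X) : Prop :=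
  ∀ n : ℕ, x (n + 1) = (1 - α (n + 1)) • x n + α (n + 1) • (T (x n) + e (n + 1))

/-- The iterates stay in `C` and their images under `T` stay within a finite distance `κ`
of the starting point. -/
def StaysInWithBoundedImages {X : Type*} [NormedAddCommGroup X]
    (C : Set X) (T : X → X) (x : ℕ → X) : Prop :=
  ∃ κ : ℝ, 0 ≤ κ ∧ ∀ n : ℕ, x n ∈ C ∧ ‖T (x n) - x 0‖ ≤ κ

/-! The residual is dominated by survival probabilities of a random walk. Nonexpansiveness and the
recursion bound the distances `‖x m - x (m + d)‖` and `‖x m - T (x (m + d))‖` through each other.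
Advancing the later index adds a Bernoulli(`α`) variable to a level, advancing the earlier one
subtracts one; doing both with the same parameter is a lazy symmetric step of probability `p = α (1
- α)` each way, absorbed at level 0 because `x m - x m = 0`. Thus `stepSum α` is the clock of the
walk, and starting from level 1 it survives for time `t` with probability of order `1 / √t`. In
place of the exact probability there is an explicit supersolution `barrier` (`barrier_step`). One
copy of weight `κ`, plus one copy launched by each error, yields `norm_sub_map_le`: the residual is
at most a multiple of `κ / √(1 + τ n)` plus the convolution of `α k * ‖e k‖` with `1 / √(1 + τ n - τ
k)`. The rates follow on comparing that convolution with `∫ s ^ (-a) / √(1 + t - s) ds`, split at `s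
= t / 2` (`exists_bound_of_isBigO`, `rates_of_bound`). The two special step-size rules only require
comparing the clock with `n` or `log n`. -/

/-! ### A supersolution for the absorbed lazy walk. -/

lemma inv_sqrt_add_lower {T p : ℝ} (hT : 0 < T) (hp : 0 ≤ p) :
    1 / √T - p / 2 * (1 / √T) ^ 3 ≤ 1 / √(T + p) := by
  have h1 : 0 < √T := Real.sqrt_pos.2 hT
  have h2 : √T ≤ √(T + p) := Real.sqrt_le_sqrt (by linarith)
  have h3 : √T ^ 2 = T := Real.sq_sqrt hT.le
  have h4 : √(T + p) ^ 2 = T + p := Real.sq_sqrt (by linarith)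
  set u := √T
  set v := √(T + p)
  have hv : 0 < v := lt_of_lt_of_le h1 h2
  have hp' : p = v ^ 2 - u ^ 2 := by linarith
  rw [hp', ← sub_nonneg]
  have : 1 / v - (1 / u - (v ^ 2 - u ^ 2) / 2 * (1 / u) ^ 3)
      = (v - u) ^ 2 * (v + 2 * u) / (2 * u ^ 3 * v) := by
    field_simp
    ring
  rw [this]
  positivity

/-- A supersolution of the lazy random walk absorbed at `0`, started from the constant `1`. -/
noncomputable def barrier (t s : ℝ) : ℝ :=
  if 4 * (4 + t) ≤ s ^ 2 then 1
  else min 1 (3 * (s * (1 / √(4 + t))) - (s * (1 / √(4 + t))) ^ 3 / 4)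

lemma barrier_le_one (t s : ℝ) : barrier t s ≤ 1 := by
  unfold barrier
  split_ifs
  · exact le_rfl
  · exact min_le_left _ _

lemma barrier_zero_right {t : ℝ} (ht : 0 ≤ t) : barrier t 0 = 0 := by
  unfold barrier
  rw [if_neg (by nlinarith)]
  simp

lemma barrier_zero_left {s : ℝ} (hs : 1 ≤ s) : barrier 0 s = 1 := by
  unfold barrier
  split_ifs with h
  · rfl
  · have h4 : √(4 + 0 : ℝ) = 2 := by
      rw [Real.sqrt_eq_iff_mul_self_eq (by norm_num) (by norm_num)]; norm_num
    rw [h4, min_eq_left]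
    have : s ≤ 4 := by nlinarith
    nlinarith [mul_nonneg (sub_nonneg.2 hs) (sub_nonneg.2 this),
      mul_nonneg (mul_nonneg (sub_nonneg.2 hs) (sub_nonneg.2 this)) (by linarith : 0 ≤ s)]

/-- With `z = s / √(4 + t)`, the profile `3z - z³/4` still exceeds 1 on `[2, 3]`. The constant
branch starts at `z = 2`, before the cubic turns down and eventually becomes negative; the slack up
to `z = 3` accommodates neighbouring levels. -/
lemma barrier_le_cubic {t s : ℝ} (ht : 0 ≤ t) (hs : 0 ≤ s) (h : s ^ 2 ≤ 9 * (4 + t)) :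
    barrier t s ≤ 3 * (s * (1 / √(4 + t))) - (s * (1 / √(4 + t))) ^ 3 / 4 := by
  unfold barrier
  split_ifs with h4
  · have hu : 0 < √(4 + t) := Real.sqrt_pos.2 (by linarith)
    have h3 : √(4 + t) ^ 2 = 4 + t := Real.sq_sqrt (by linarith)
    have hz2 : 2 ≤ s * (1 / √(4 + t)) := by
      rw [mul_one_div, le_div_iff₀ hu]
      exact le_of_sq_le_sq (by nlinarith) hs
    have hz3 : s * (1 / √(4 + t)) ≤ 3 := by
      rw [mul_one_div, div_le_iff₀ hu]
      exact le_of_sq_le_sq (by nlinarith) (by positivity)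
    set z := s * (1 / √(4 + t))
    nlinarith [mul_nonneg (sub_nonneg.2 hz2) (sub_nonneg.2 hz3),
      mul_nonneg (mul_nonneg (sub_nonneg.2 hz2) (sub_nonneg.2 hz3)) (by linarith : 0 ≤ z)]
  · exact min_le_right _ _

lemma barrier_at_one {t : ℝ} (ht : 0 ≤ t) : barrier t 1 ≤ 3 / √(1 + t) := by
  refine (barrier_le_cubic ht zero_le_one (by linarith)).trans ?_
  have h1 : 0 < √(1 + t) := Real.sqrt_pos.2 (by linarith)
  have h2 : √(1 + t) ≤ √(4 + t) := Real.sqrt_le_sqrt (by linarith)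
  have h3 : 1 / √(4 + t) ≤ 1 / √(1 + t) := one_div_le_one_div_of_le h1 h2
  have h4 : 0 ≤ (1 * (1 / √(4 + t))) ^ 3 / 4 := by positivity
  have h5 : 3 / √(1 + t) = 3 * (1 / √(1 + t)) := by ring
  rw [h5]
  linarith

/-- The second difference of `s³` is `6s`, so the cubic term drops by `(3/2) p s r³`, where `r = 1 /
√(4 + t)`. This is exactly the most that `3 s r` can lose when the clock advances by `p`, by the
tangent-line bound `inv_sqrt_add_lower`; hence the coefficient `1/4`. -/
lemma barrier_step {t p s : ℝ} (ht : 0 ≤ t) (hp : 0 ≤ p) (hp4 : p ≤ 1 / 4) (hs : 1 ≤ s) :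
    (1 - 2 * p) * barrier t s + p * (barrier t (s + 1) + barrier t (s - 1))
      ≤ barrier (t + p) s := by
  have hle : (1 - 2 * p) * barrier t s + p * (barrier t (s + 1) + barrier t (s - 1)) ≤ 1 := by
    nlinarith [mul_le_mul_of_nonneg_left (barrier_le_one t s) (by linarith : 0 ≤ 1 - 2 * p),
      mul_le_mul_of_nonneg_left (barrier_le_one t (s + 1)) hp,
      mul_le_mul_of_nonneg_left (barrier_le_one t (s - 1)) hp]
  conv_rhs => unfold barrier
  split_ifs with h
  · exact hle
  · refine le_min hle ?_
    push Not at h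
    -- Below the constant branch at time `t + p`, the level `s + 1` stays within the range of
    -- `barrier_le_cubic` at time `t`.
    have hs1 : (s + 1) ^ 2 ≤ 9 * (4 + t) := by
      have : 2 * s ≤ 5 * t + 18 := by
        refine le_of_sq_le_sq ?_ (by linarith)
        nlinarith
      nlinarith
    have b0 := barrier_le_cubic ht (by linarith : 0 ≤ s) (by nlinarith)
    have b1 := barrier_le_cubic ht (by linarith : 0 ≤ s + 1) hs1
    have b2 := barrier_le_cubic ht (by linarith : 0 ≤ s - 1) (by nlinarith)
    have hr := inv_sqrt_add_lower (by linarith : 0 < 4 + t) hp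
    have hr' : 1 / √(4 + (t + p)) ≤ 1 / √(4 + t) :=
      one_div_le_one_div_of_le (Real.sqrt_pos.2 (by linarith)) (Real.sqrt_le_sqrt (by linarith))
    have hr0 : 0 ≤ 1 / √(4 + (t + p)) := by positivity
    rw [add_assoc] at hr
    generalize 1 / √(4 + t) = r at *
    generalize 1 / √(4 + (t + p)) = r' at *
    have c : r' ^ 3 ≤ r ^ 3 := pow_le_pow_left₀ hr0 hr' 3
    have c' : s ^ 3 * r' ^ 3 ≤ s ^ 3 * r ^ 3 := mul_le_mul_of_nonneg_left c (by positivity)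
    have d := mul_le_mul_of_nonneg_left hr (by linarith : 0 ≤ 3 * s)
    have e0 := mul_le_mul_of_nonneg_left b0 (by linarith : 0 ≤ 1 - 2 * p)
    have e1 := mul_le_mul_of_nonneg_left b1 hp
    have e2 := mul_le_mul_of_nonneg_left b2 hp
    calc _ ≤ (1 - 2 * p) * (3 * (s * r) - (s * r) ^ 3 / 4)
          + p * ((3 * ((s + 1) * r) - ((s + 1) * r) ^ 3 / 4)
            + (3 * ((s - 1) * r) - ((s - 1) * r) ^ 3 / 4)) := by
          rw [mul_add p, mul_add p]
          exact add_le_add e0 (add_le_add e1 e2)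
      _ = 3 * s * (r - p / 2 * r ^ 3) - s ^ 3 * r ^ 3 / 4 := by ring
      _ ≤ _ := by rw [mul_pow]; linarith

/-! ### The clock and the superposition of barriers. -/

lemma stepSum_zero (α : ℕ → ℝ) : stepSum α 0 = 0 := by simp [stepSum]

lemma stepSum_succ (α : ℕ → ℝ) (n : ℕ) :
    stepSum α (n + 1) = stepSum α n + α (n + 1) * (1 - α (n + 1)) := by
  simp [stepSum, Finset.sum_Icc_succ_top]

lemma stepSum_mono {α : ℕ → ℝ} (hα : ∀ n : ℕ, 1 ≤ n → 0 ≤ α n ∧ α n ≤ 1) :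
    Monotone (stepSum α) := by
  refine monotone_nat_of_le_succ fun n => ?_
  have := hα (n + 1) (by omega)
  rw [stepSum_succ]
  nlinarith [mul_nonneg this.1 (sub_nonneg.2 this.2)]

/-- Superposition of barriers: the initial datum has weight `κ`, and the error made at time `k`
contributes the weight `2 * α k * ε k` from time `k` on. -/
noncomputable def barrierSum (κ : ℝ) (α ε : ℕ → ℝ) (n : ℕ) (s : ℕ) : ℝ :=
  κ * barrier (stepSum α n) s +
    ∑ k ∈ Finset.Icc 1 n, 2 * α k * ε k * barrier (stepSum α n - stepSum α k) s

lemma barrierSum_zero_right {α : ℕ → ℝ} (hα : ∀ n : ℕ, 1 ≤ n → 0 ≤ α n ∧ α n ≤ 1)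
    (κ : ℝ) (ε : ℕ → ℝ) (n : ℕ) : barrierSum κ α ε n 0 = 0 := by
  have hm := stepSum_mono hα
  have h0 : 0 ≤ stepSum α n := by simpa [stepSum_zero] using hm (Nat.zero_le n)
  unfold barrierSum
  rw [Nat.cast_zero, barrier_zero_right h0, Finset.sum_eq_zero, mul_zero, add_zero]
  intro k hk
  rw [barrier_zero_right (sub_nonneg.2 (hm (Finset.mem_Icc.1 hk).2)), mul_zero]

lemma barrierSum_zero_left (κ : ℝ) (α ε : ℕ → ℝ) (s : ℕ) :
    barrierSum κ α ε 0 (s + 1) = κ := by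
  have : (1 : ℝ) ≤ ((s + 1 : ℕ) : ℝ) := by simp
  simp [barrierSum, stepSum_zero, -Nat.cast_add, barrier_zero_left this]

lemma barrierSum_step {κ : ℝ} {α ε : ℕ → ℝ} (hκ : 0 ≤ κ)
    (hα : ∀ n : ℕ, 1 ≤ n → 0 ≤ α n ∧ α n ≤ 1) (hε : ∀ n, 0 ≤ ε n) (n s : ℕ) :
    (1 - 2 * (α (n + 1) * (1 - α (n + 1)))) * barrierSum κ α ε n (s + 1)
      + α (n + 1) * (1 - α (n + 1)) * (barrierSum κ α ε n (s + 2) + barrierSum κ α ε n s)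
      + 2 * α (n + 1) * ε (n + 1) ≤ barrierSum κ α ε (n + 1) (s + 1) := by
  have hm := stepSum_mono hα
  have h0 : 0 ≤ stepSum α n := by simpa [stepSum_zero] using hm (Nat.zero_le n)
  obtain ⟨ha0, ha1⟩ := hα (n + 1) (by omega)
  have hp0 : 0 ≤ α (n + 1) * (1 - α (n + 1)) := mul_nonneg ha0 (sub_nonneg.2 ha1)
  have hp4 : α (n + 1) * (1 - α (n + 1)) ≤ 1 / 4 := by nlinarith [sq_nonneg (α (n + 1) - 1 / 2)]
  have hs : (1 : ℝ) ≤ ((s + 1 : ℕ) : ℝ) := by simp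
  have key : ∀ t : ℝ, 0 ≤ t →
      (1 - 2 * (α (n + 1) * (1 - α (n + 1)))) * barrier t ((s + 1 : ℕ) : ℝ)
      + α (n + 1) * (1 - α (n + 1)) * (barrier t ((s + 2 : ℕ) : ℝ) + barrier t (s : ℝ))
      ≤ barrier (t + α (n + 1) * (1 - α (n + 1))) ((s + 1 : ℕ) : ℝ) := by
    intro t ht
    have := barrier_step ht hp0 hp4 hs
    have e1 : ((s + 1 : ℕ) : ℝ) + 1 = ((s + 2 : ℕ) : ℝ) := by push_cast; ring
    have e2 : ((s + 1 : ℕ) : ℝ) - 1 = (s : ℝ) := by push_cast; ring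
    rwa [e1, e2] at this
  have main : ∀ k ∈ Finset.Icc 1 n,
      2 * α k * ε k * ((1 - 2 * (α (n + 1) * (1 - α (n + 1)))) *
        barrier (stepSum α n - stepSum α k) ((s + 1 : ℕ) : ℝ)
      + α (n + 1) * (1 - α (n + 1)) * (barrier (stepSum α n - stepSum α k) ((s + 2 : ℕ) : ℝ)
        + barrier (stepSum α n - stepSum α k) (s : ℝ)))
      ≤ 2 * α k * ε k * barrier (stepSum α (n + 1) - stepSum α k) ((s + 1 : ℕ) : ℝ) := by
    intro k hk
    rw [Finset.mem_Icc] at hk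
    have := key _ (sub_nonneg.2 (hm hk.2))
    rw [stepSum_succ, add_sub_right_comm]
    exact mul_le_mul_of_nonneg_left this
      (mul_nonneg (mul_nonneg zero_le_two (hα k hk.1).1) (hε k))
  have hsum := Finset.sum_le_sum main
  have hκ' := mul_le_mul_of_nonneg_left (key _ h0) hκ
  rw [← stepSum_succ] at hκ'
  -- A barrier launched now has age 0 and equals 1 at every positive level, so the new error enters
  -- with its full weight.
  have hlast : 2 * α (n + 1) * ε (n + 1) *
      barrier (stepSum α (n + 1) - stepSum α (n + 1)) ((s + 1 : ℕ) : ℝ)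
      = 2 * α (n + 1) * ε (n + 1) := by
    rw [sub_self, barrier_zero_left hs, mul_one]
  unfold barrierSum
  rw [Finset.sum_Icc_succ_top (by omega : 1 ≤ n + 1), hlast]
  calc _ = κ * ((1 - 2 * (α (n + 1) * (1 - α (n + 1)))) *
        barrier (stepSum α n) ((s + 1 : ℕ) : ℝ)
      + α (n + 1) * (1 - α (n + 1)) * (barrier (stepSum α n) ((s + 2 : ℕ) : ℝ)
        + barrier (stepSum α n) (s : ℝ))) + ∑ k ∈ Finset.Icc 1 n,
      2 * α k * ε k * ((1 - 2 * (α (n + 1) * (1 - α (n + 1)))) *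
        barrier (stepSum α n - stepSum α k) ((s + 1 : ℕ) : ℝ)
      + α (n + 1) * (1 - α (n + 1)) * (barrier (stepSum α n - stepSum α k) ((s + 2 : ℕ) : ℝ)
        + barrier (stepSum α n - stepSum α k) (s : ℝ))) + 2 * α (n + 1) * ε (n + 1) := by
        simp only [mul_add, Finset.mul_sum, Finset.sum_add_distrib, mul_left_comm]
        ring
    _ ≤ _ := by linarith

/-! ### Bernoulli averaging of the level. -/

/-- The mean of `barrierSum` after adding to the level independent Bernoulli variables with
parameters `α (m + 1), …, α (m + d)`. -/
noncomputable def averagedBarrier (κ : ℝ) (α ε : ℕ → ℝ) (m : ℕ) : ℕ → ℕ → ℝ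
  | 0, s => barrierSum κ α ε m s
  | d + 1, s => (1 - α (m + d + 1)) * averagedBarrier κ α ε m d s
      + α (m + d + 1) * averagedBarrier κ α ε m d (s + 1)

lemma averagedBarrier_succ (κ : ℝ) (α ε : ℕ → ℝ) (m d s : ℕ) :
    averagedBarrier κ α ε m (d + 1) s = (1 - α (m + d + 1)) * averagedBarrier κ α ε m d s
      + α (m + d + 1) * averagedBarrier κ α ε m d (s + 1) := rfl

/-- For `d = 0`, the two averages with parameter `α (m + 1)`, one up and one down, compose to the
lazy step of `barrierSum_step`. Averages with later parameters preserve the inequality. -/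
lemma averagedBarrier_step {κ : ℝ} {α ε : ℕ → ℝ} (hκ : 0 ≤ κ)
    (hα : ∀ n : ℕ, 1 ≤ n → 0 ≤ α n ∧ α n ≤ 1) (hε : ∀ n, 0 ≤ ε n) (m d s : ℕ) :
    (1 - α (m + 1)) * averagedBarrier κ α ε m (d + 1) (s + 1)
      + α (m + 1) * averagedBarrier κ α ε m (d + 1) s + 2 * α (m + 1) * ε (m + 1)
      ≤ averagedBarrier κ α ε (m + 1) d (s + 1) := by
  induction d generalizing s with
  | zero =>
    simp only [averagedBarrier, add_zero]
    refine le_trans (le_of_eq ?_) (barrierSum_step hκ hα hε m s)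
    ring
  | succ d ih =>
    obtain ⟨ha0, ha1⟩ := hα (m + (d + 1) + 1) (by omega)
    have i1 := mul_le_mul_of_nonneg_left (ih s) (sub_nonneg.2 ha1)
    have i2 := mul_le_mul_of_nonneg_left (ih (s + 1)) ha0
    have e : m + 1 + d + 1 = m + (d + 1) + 1 := by ring
    rw [averagedBarrier_succ _ _ _ m (d + 1) (s + 1), averagedBarrier_succ _ _ _ m (d + 1) s,
      averagedBarrier_succ _ _ _ (m + 1) d (s + 1), e]
    linarith

lemma averagedBarrier_zero_left {κ : ℝ} {α ε : ℕ → ℝ} (d s : ℕ) :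
    averagedBarrier κ α ε 0 d (s + 1) = κ := by
  induction d generalizing s with
  | zero => exact barrierSum_zero_left κ α ε s
  | succ d ih => rw [averagedBarrier, ih, ih]; ring

/-! ### Domination of the iterates by the walk. -/

section Iteration

variable {X : Type*} [NormedAddCommGroup X] [NormedSpace ℝ X]

lemma norm_convex_step_le {c : ℝ} (h0 : 0 ≤ c) (h1 : c ≤ 1) (u v w y : X) :
    ‖((1 - c) • u + c • (v + w)) - y‖ ≤ (1 - c) * ‖u - y‖ + c * ‖v - y‖ + c * ‖w‖ := by
  have : ((1 - c) • u + c • (v + w)) - y = (1 - c) • (u - y) + c • (v - y) + c • w := by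
    module
  rw [this]
  refine (norm_add₃_le).trans ?_
  rw [norm_smul, norm_smul, norm_smul, Real.norm_of_nonneg h0,
    Real.norm_of_nonneg (sub_nonneg.2 h1)]

/-- Level 0 tracks distances to iterates, level 1 distances to images. The induction runs on `m` for
all `d` at once, since the bound at `(m + 1, d)` uses both bounds at `(m, d + 1)`. -/
lemma norm_sub_le_averagedBarrier {C : Set X} {T : X → X} (hT : LipschitzOnWith 1 T C)
    {α : ℕ → ℝ} (hα : ∀ n : ℕ, 1 ≤ n → 0 ≤ α n ∧ α n ≤ 1) {e x : ℕ → X}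
    (hx : IsInexactKM T α e x) {κ : ℝ} (hκ : 0 ≤ κ)
    (hC : ∀ n : ℕ, x n ∈ C ∧ ‖T (x n) - x 0‖ ≤ κ) (m d : ℕ) :
    ‖x m - x (m + d)‖ ≤ averagedBarrier κ α (fun n => ‖e n‖) m d 0
        + ∑ i ∈ Finset.range d, α (m + i + 1) * ‖e (m + i + 1)‖ ∧
    ‖x m - T (x (m + d))‖ ≤ averagedBarrier κ α (fun n => ‖e n‖) m d 1
        + ∑ i ∈ Finset.range d, α (m + i + 1) * ‖e (m + i + 1)‖ := by
  have fill : ∀ m : ℕ, (∀ d, ‖x m - T (x (m + d))‖ ≤ averagedBarrier κ α (fun n => ‖e n‖) m d 1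
        + ∑ i ∈ Finset.range d, α (m + i + 1) * ‖e (m + i + 1)‖) → ∀ d,
      ‖x m - x (m + d)‖ ≤ averagedBarrier κ α (fun n => ‖e n‖) m d 0
        + ∑ i ∈ Finset.range d, α (m + i + 1) * ‖e (m + i + 1)‖ := by
    intro m hB d
    induction d with
    | zero => simp [averagedBarrier, barrierSum_zero_right hα]
    | succ d ih =>
      obtain ⟨ha0, ha1⟩ := hα (m + d + 1) (by omega)
      have h := norm_convex_step_le ha0 ha1 (x (m + d)) (T (x (m + d))) (e (m + d + 1)) (x m)
      rw [← hx (m + d), norm_sub_rev _ (x m), norm_sub_rev _ (x m), norm_sub_rev _ (x m)] at h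
      rw [averagedBarrier, Finset.sum_range_succ, ← add_assoc m d 1]
      have i1 := mul_le_mul_of_nonneg_left ih (sub_nonneg.2 ha1)
      have i2 := mul_le_mul_of_nonneg_left (hB d) ha0
      rw [zero_add]
      linarith
  suffices hB : ∀ m d, ‖x m - T (x (m + d))‖ ≤ averagedBarrier κ α (fun n => ‖e n‖) m d 1
        + ∑ i ∈ Finset.range d, α (m + i + 1) * ‖e (m + i + 1)‖ from
    ⟨fill m (hB m) d, hB m d⟩
  intro m
  induction m with
  | zero =>
    intro d
    rw [averagedBarrier_zero_left d 0, norm_sub_rev]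
    have : 0 ≤ ∑ i ∈ Finset.range d, α (0 + i + 1) * ‖e (0 + i + 1)‖ :=
      Finset.sum_nonneg fun i _ => mul_nonneg (hα _ (by omega)).1 (norm_nonneg _)
    linarith [(hC (0 + d)).2]
  | succ m ih =>
    intro d
    obtain ⟨ha0, ha1⟩ := hα (m + 1) (by omega)
    have hA := fill m ih (d + 1)
    have hB := ih (d + 1)
    have h := norm_convex_step_le ha0 ha1 (x m) (T (x m)) (e (m + 1)) (T (x (m + 1 + d)))
    rw [← hx m] at h
    have hl : ‖T (x m) - T (x (m + 1 + d))‖ ≤ ‖x m - x (m + 1 + d)‖ := by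
      simpa using hT.norm_sub_le (hC m).1 (hC (m + 1 + d)).1
    have st := averagedBarrier_step hκ hα (fun n => norm_nonneg (e n)) m d 0
    have en : m + (d + 1) = m + 1 + d := by ring
    -- This isolates `α (m + 1) * ‖e (m + 1)‖`. A second copy comes from the step `x m ↦ x (m + 1)`
    -- in `h`, whence the factor 2 in `barrierSum`.
    rw [Finset.sum_range_succ'] at hA hB
    simp only [en, add_zero, zero_add] at hA hB st
    have es : ∑ i ∈ Finset.range d, α (m + (i + 1) + 1) * ‖e (m + (i + 1) + 1)‖
        = ∑ i ∈ Finset.range d, α (m + 1 + i + 1) * ‖e (m + 1 + i + 1)‖ :=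
      Finset.sum_congr rfl fun i _ => by rw [add_right_comm m 1 i, add_assoc m i 1]
    rw [es] at hA hB
    have i1 := mul_le_mul_of_nonneg_left hB (sub_nonneg.2 ha1)
    have i2 := mul_le_mul_of_nonneg_left (hl.trans hA) ha0
    linarith

theorem norm_sub_map_le {C : Set X} {T : X → X} (hT : LipschitzOnWith 1 T C)
    {α : ℕ → ℝ} (hα : ∀ n : ℕ, 1 ≤ n → 0 ≤ α n ∧ α n ≤ 1) {e x : ℕ → X}
    (hx : IsInexactKM T α e x) {κ : ℝ} (hκ : 0 ≤ κ)
    (hC : ∀ n : ℕ, x n ∈ C ∧ ‖T (x n) - x 0‖ ≤ κ) (n : ℕ) :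
    ‖x n - T (x n)‖ ≤ κ * (3 / √(1 + stepSum α n)) +
      ∑ k ∈ Finset.Icc 1 n, 2 * α k * ‖e k‖ * (3 / √(1 + (stepSum α n - stepSum α k))) := by
  have hm := stepSum_mono hα
  have h0 : 0 ≤ stepSum α n := by simpa [stepSum_zero] using hm (Nat.zero_le n)
  have h := (norm_sub_le_averagedBarrier hT hα hx hκ hC n 0).2
  simp only [averagedBarrier, Finset.range_zero, Finset.sum_empty, add_zero, barrierSum,
    Nat.cast_one] at h
  refine h.trans (add_le_add (mul_le_mul_of_nonneg_left (barrier_at_one h0) hκ) ?_)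
  refine Finset.sum_le_sum fun k hk => ?_
  rw [Finset.mem_Icc] at hk
  exact mul_le_mul_of_nonneg_left (barrier_at_one (sub_nonneg.2 (hm hk.2)))
    (mul_nonneg (mul_nonneg zero_le_two (hα k hk.1).1) (norm_nonneg _))

end Iteration

/-! ### Comparison of sums with integrals. -/

lemma sum_Ioc_le_sub {u G : ℕ → ℝ} {N n : ℕ} (hn : N ≤ n)
    (h : ∀ k, N ≤ k → k < n → u (k + 1) ≤ G (k + 1) - G k) :
    ∑ k ∈ Finset.Ioc N n, u k ≤ G n - G N := by
  induction n, hn using Nat.le_induction with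
  | base => simp
  | succ n hn ih =>
    rw [Finset.sum_Ioc_succ_top hn]
    have := ih fun k h1 h2 => h k h1 (by omega)
    linarith [h n hn (by omega)]

lemma div_sqrt_one_add_le {p y : ℝ} (hp : 0 ≤ p) (hp4 : p ≤ 1 / 4) (hy : 0 ≤ y) :
    p / √(1 + y) ≤ 3 * (√(1 + (y + p)) - √(1 + y)) := by
  have h1 : 0 < √(1 + y) := Real.sqrt_pos.2 (by linarith)
  have h2 : √(1 + y) ^ 2 = 1 + y := Real.sq_sqrt (by linarith)
  have h3 : √(1 + (y + p)) ^ 2 = 1 + (y + p) := Real.sq_sqrt (by linarith)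
  have h4 : √(1 + y) ≤ √(1 + (y + p)) := Real.sqrt_le_sqrt (by linarith)
  have h5 : √(1 + (y + p)) ≤ 2 * √(1 + y) :=
    le_of_sq_le_sq (by nlinarith) (by positivity)
  rw [div_le_iff₀ h1]
  set u := √(1 + y)
  set v := √(1 + (y + p))
  have : p = (v - u) * (v + u) := by linear_combination h2 - h3
  rw [this]
  nlinarith [mul_nonneg (sub_nonneg.2 h4) (sub_nonneg.2 h5)]

/-- Since `(1 + s) (1 + t - s) = 1 + t + s (t - s) ≥ t`. It serves the finitely many early errors,
on which the asymptotic hypothesis says nothing. -/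
lemma one_div_sqrt_sub_le {s t : ℝ} (hs : 0 ≤ s) (hst : s ≤ t) (ht : 0 < t) :
    1 / √(1 + (t - s)) ≤ √(1 + s) / √t := by
  rw [div_le_div_iff₀ (Real.sqrt_pos.2 (by linarith)) (Real.sqrt_pos.2 ht), one_mul,
    ← Real.sqrt_mul (by linarith)]
  exact Real.sqrt_le_sqrt (by nlinarith [mul_nonneg hs (sub_nonneg.2 hst)])

/-- For `s ≤ t / 2` the kernel is comparable to `1 / √t`; for `s ≥ t / 2` the power is comparable to
`t ^ (-a)`. Adding both bounds avoids splitting the sum. -/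
lemma rpow_neg_div_sqrt_le {a s t : ℝ} (ha : 0 ≤ a) (hs : 0 < s) (hst : s ≤ t) :
    s ^ (-a) / √(1 + (t - s)) ≤
      2 * (s ^ (-a) / √t) + 2 ^ a * t ^ (-a) / √(1 + (t - s)) := by
  have ht : 0 < t := hs.trans_le hst
  have hsq : 0 < √t := Real.sqrt_pos.2 ht
  have hsa : 0 ≤ s ^ (-a) := Real.rpow_nonneg hs.le _
  rcases le_total (2 * s) t with h | h
  · have h1 : √t ≤ 2 * √(1 + (t - s)) := by
      refine le_of_sq_le_sq ?_ (by positivity)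
      rw [mul_pow, Real.sq_sqrt ht.le, Real.sq_sqrt (by linarith)]
      linarith
    have h2 : s ^ (-a) / √(1 + (t - s)) ≤ 2 * (s ^ (-a) / √t) := by
      rw [← mul_div_assoc, div_le_div_iff₀ (Real.sqrt_pos.2 (by linarith)) hsq]
      nlinarith [mul_le_mul_of_nonneg_left h1 hsa]
    have : 0 ≤ 2 ^ a * t ^ (-a) / √(1 + (t - s)) := by positivity
    linarith
  · have h1 : s ^ (-a) ≤ 2 ^ a * t ^ (-a) := by
      have : (t / 2) ^ (-a) = 2 ^ a * t ^ (-a) := by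
        rw [Real.div_rpow ht.le zero_le_two, Real.rpow_neg zero_le_two, div_inv_eq_mul, mul_comm]
      rw [← this]
      exact Real.rpow_le_rpow_of_nonpos (by linarith) (by linarith) (by linarith)
    have h2 := div_le_div_of_nonneg_right h1 (Real.sqrt_nonneg (1 + (t - s)))
    have : 0 ≤ 2 * (s ^ (-a) / √t) := by positivity
    linarith

/-- Here and in the next two lemmas, the right-endpoint rectangle of a decreasing power lies below
its integral over `[s, t]`. -/
lemma sub_mul_rpow_neg_one_le {s t : ℝ} (hs : 0 < s) (hst : s ≤ t) :
    (t - s) * t ^ (-1 : ℝ) ≤ Real.log t - Real.log s := by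
  have ht := hs.trans_le hst
  have h := Real.one_sub_inv_le_log_of_pos (div_pos ht hs)
  rw [Real.log_div ht.ne' hs.ne', inv_div] at h
  rw [Real.rpow_neg_one]
  refine le_trans (le_of_eq ?_) h
  field_simp

lemma sub_mul_rpow_neg_le_of_lt_one {a s t : ℝ} (ha : 0 ≤ a) (ha1 : a < 1) (hs : 0 < s)
    (hst : s ≤ t) : (t - s) * t ^ (-a) ≤ t ^ (1 - a) / (1 - a) - s ^ (1 - a) / (1 - a) := by
  have ht := hs.trans_le hst
  have hb : 0 < 1 - a := by linarith
  have h := rpow_one_add_le_one_add_mul_self (s := s / t - 1)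
    (by linarith [div_pos hs ht]) hb.le (by linarith)
  rw [add_sub_cancel, Real.div_rpow hs.le ht.le, div_le_iff₀ (Real.rpow_pos_of_pos ht _)] at h
  have e : t ^ (1 - a) = t * t ^ (-a) := by
    rw [sub_eq_add_neg, Real.rpow_add ht, Real.rpow_one]
  rw [← sub_div, le_div_iff₀ hb]
  have e2 : (1 + (1 - a) * (s / t - 1)) * t ^ (1 - a)
      = t ^ (1 - a) - (1 - a) * ((t - s) * t ^ (-a)) := by
    rw [e]
    field_simp
    ring
  linarith

/-- Combines `(t / s) ^ (a - 1) ≥ 1 + (a - 1) log (t / s)` with the logarithmic case. -/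
lemma sub_mul_rpow_neg_le_of_one_lt {a s t : ℝ} (ha1 : 1 < a) (hs : 0 < s)
    (hst : s ≤ t) : (t - s) * t ^ (-a) ≤ s ^ (1 - a) / (a - 1) - t ^ (1 - a) / (a - 1) := by
  have ht := hs.trans_le hst
  have hb : 0 < a - 1 := by linarith
  have h := sub_mul_rpow_neg_one_le hs hst
  have h1 := Real.add_one_le_exp ((1 - a) * Real.log (s / t))
  rw [mul_comm (1 - a), ← Real.rpow_def_of_pos (div_pos hs ht), Real.div_rpow hs.le ht.le,
    Real.log_div hs.ne' ht.ne', le_div_iff₀ (Real.rpow_pos_of_pos ht _)] at h1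
  have e : t ^ (1 - a) * t ^ (-1 : ℝ) = t ^ (-a) := by
    rw [← Real.rpow_add ht]; congr 1; ring
  have h2 := mul_le_mul_of_nonneg_left h
    (mul_nonneg hb.le (Real.rpow_nonneg ht.le (1 - a)))
  have e2 : (a - 1) * t ^ (1 - a) * ((t - s) * t ^ (-1 : ℝ)) = (t - s) * t ^ (-a) * (a - 1) := by
    rw [← e]; ring
  rw [← sub_div, le_div_iff₀ hb]
  linarith

/-! ### From the convolution bound to rates in the clock. -/

section Rates

variable {α : ℕ → ℝ} {f ε : ℕ → ℝ} {a : ℝ}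

lemma exists_bound_of_isBigO (hα : ∀ n : ℕ, 1 ≤ n → 0 ≤ α n ∧ α n ≤ 1) {κ : ℝ} (hκ : 0 ≤ κ)
    (hε : ∀ n, 0 ≤ ε n) (ha : 0 ≤ a)
    (hf : ∀ n, f n ≤ κ * (3 / √(1 + stepSum α n)) +
      ∑ k ∈ Finset.Icc 1 n, 2 * α k * ε k * (3 / √(1 + (stepSum α n - stepSum α k))))
    (hτ : Tendsto (stepSum α) atTop atTop)
    (he : ε =O[atTop] fun n => (1 - α n) / stepSum α n ^ a) :
    ∃ C : ℝ, ∃ N : ℕ, 0 ≤ C ∧ ∀ n, N ≤ n → 1 ≤ stepSum α n ∧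
      f n ≤ C / √(stepSum α n) * (1 + ∑ k ∈ Finset.Ioc N n,
        α k * (1 - α k) * stepSum α k ^ (-a) + stepSum α n ^ (1 - a)) := by
  obtain ⟨M, hM, hb⟩ := he.exists_pos
  obtain ⟨N, hN⟩ := eventually_atTop.1
    (hb.bound.and ((eventually_ge_atTop 1).and (hτ.eventually_ge_atTop 1)))
  have hm := stepSum_mono hα
  have hnn : ∀ n, 0 ≤ stepSum α n := fun n => by
    simpa [stepSum_zero] using hm (Nat.zero_le n)
  have hp0 : ∀ k, 1 ≤ k → 0 ≤ α k * (1 - α k) := fun k hk =>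
    mul_nonneg (hα k hk).1 (sub_nonneg.2 (hα k hk).2)
  -- `D` collects the errors up to `N`, each of which contributes `O(1 / √τ)`.
  set D : ℝ := ∑ k ∈ Finset.Ioc 0 N, 6 * α k * ε k * √(1 + stepSum α k) with hD
  have hD0 : 0 ≤ D := Finset.sum_nonneg fun k hk => by
    have := (hα k (Finset.mem_Ioc.1 hk).1).1
    have := hε k
    positivity
  refine ⟨3 * κ + D + 12 * M + 36 * M * 2 ^ a, N, by positivity, fun n hn => ⟨(hN n hn).2.2, ?_⟩⟩
  have hτ1 := (hN n hn).2.2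
  have hτ0 : 0 < stepSum α n := by linarith
  have hsq : 0 < √(stepSum α n) := Real.sqrt_pos.2 hτ0
  set S := ∑ k ∈ Finset.Ioc N n, α k * (1 - α k) * stepSum α k ^ (-a) with hS
  have hS0 : 0 ≤ S := Finset.sum_nonneg fun k hk =>
    mul_nonneg (hp0 k (by have := (Finset.mem_Ioc.1 hk).1; omega)) (Real.rpow_nonneg (hnn k) _)
  have b1 : κ * (3 / √(1 + stepSum α n)) ≤ 3 * κ / √(stepSum α n) := by
    have : 3 / √(1 + stepSum α n) ≤ 3 / √(stepSum α n) :=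
      div_le_div_of_nonneg_left (by norm_num) hsq (Real.sqrt_le_sqrt (by linarith))
    refine (mul_le_mul_of_nonneg_left this hκ).trans (le_of_eq (by ring))
  have b2 : ∑ k ∈ Finset.Ioc 0 N, 2 * α k * ε k * (3 / √(1 + (stepSum α n - stepSum α k)))
      ≤ D / √(stepSum α n) := by
    rw [hD, Finset.sum_div]
    refine Finset.sum_le_sum fun k hk => ?_
    rw [Finset.mem_Ioc] at hk
    have h := one_div_sqrt_sub_le (hnn k) (hm (hk.2.trans hn)) hτ0
    have h0 : 0 ≤ 6 * α k * ε k := mul_nonneg (mul_nonneg (by norm_num) (hα k hk.1).1) (hε k)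
    calc _ = 6 * α k * ε k * (1 / √(1 + (stepSum α n - stepSum α k))) := by ring
      _ ≤ _ := mul_le_mul_of_nonneg_left h h0
      _ = _ := by ring
  -- The kernel alone telescopes to `O(√τ)`; multiplied by `τ ^ (-a)` this is the late part `τ ^ (1
  -- - a) / √τ`.
  have b3 : ∑ k ∈ Finset.Ioc N n, α k * (1 - α k) / √(1 + (stepSum α n - stepSum α k))
      ≤ 6 * √(stepSum α n) := by
    have h := sum_Ioc_le_sub (u := fun k => α k * (1 - α k) / √(1 + (stepSum α n - stepSum α k)))
      (G := fun k => -(3 * √(1 + (stepSum α n - stepSum α k)))) hn (by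
        intro k _ hk2
        have h4 : α (k + 1) * (1 - α (k + 1)) ≤ 1 / 4 := by
          nlinarith [sq_nonneg (α (k + 1) - 1 / 2)]
        have h := div_sqrt_one_add_le (hp0 (k + 1) (by omega)) h4 (sub_nonneg.2 (hm hk2))
        have e : stepSum α n - stepSum α (k + 1) + α (k + 1) * (1 - α (k + 1))
            = stepSum α n - stepSum α k := by rw [stepSum_succ]; ring
        rw [e] at h
        linarith)
    refine h.trans ?_
    have h1 : √(1 + (stepSum α n - stepSum α N)) ≤ 2 * √(stepSum α n) := by
      refine le_of_sq_le_sq ?_ (by positivity)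
      rw [mul_pow, Real.sq_sqrt hτ0.le, Real.sq_sqrt (by linarith [hm hn])]
      linarith [hnn N]
    have h2 := Real.sqrt_nonneg (1 + (stepSum α n - stepSum α n))
    linarith
  have b4 : ∑ k ∈ Finset.Ioc N n, 2 * α k * ε k * (3 / √(1 + (stepSum α n - stepSum α k)))
      ≤ 12 * M * S / √(stepSum α n)
        + 36 * M * 2 ^ a * (stepSum α n ^ (1 - a) / √(stepSum α n)) := by
    have h1 : ∀ k ∈ Finset.Ioc N n,
        2 * α k * ε k * (3 / √(1 + (stepSum α n - stepSum α k))) ≤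
        12 * M / √(stepSum α n) * (α k * (1 - α k) * stepSum α k ^ (-a))
          + 6 * M * 2 ^ a * stepSum α n ^ (-a) *
            (α k * (1 - α k) / √(1 + (stepSum α n - stepSum α k))) := by
      intro k hk
      rw [Finset.mem_Ioc] at hk
      obtain ⟨c1, c2, c3⟩ := hN k hk.1.le
      have c4 := hα k c2
      have c5 : 0 < stepSum α k := by linarith
      have c6 : ε k ≤ M * ((1 - α k) * stepSum α k ^ (-a)) := by
        have : 0 ≤ (1 - α k) / stepSum α k ^ a :=
          div_nonneg (sub_nonneg.2 c4.2) (Real.rpow_nonneg c5.le _)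
        rwa [Real.norm_of_nonneg (hε k), Real.norm_of_nonneg this, div_eq_mul_inv,
          ← Real.rpow_neg c5.le] at c1
      have c7 := rpow_neg_div_sqrt_le ha c5 (hm hk.2)
      have c8 : 0 ≤ 6 * M * (α k * (1 - α k)) := mul_nonneg (by positivity) (hp0 k c2)
      have c9 : 0 ≤ 6 * α k / √(1 + (stepSum α n - stepSum α k)) :=
        div_nonneg (mul_nonneg (by norm_num) c4.1) (Real.sqrt_nonneg _)
      calc _ = 6 * α k / √(1 + (stepSum α n - stepSum α k)) * ε k := by ring
        _ ≤ _ := mul_le_mul_of_nonneg_left c6 c9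
        _ = 6 * M * (α k * (1 - α k)) *
            (stepSum α k ^ (-a) / √(1 + (stepSum α n - stepSum α k))) := by ring
        _ ≤ _ := mul_le_mul_of_nonneg_left c7 c8
        _ = _ := by ring
    refine (Finset.sum_le_sum h1).trans ?_
    rw [Finset.sum_add_distrib, ← Finset.mul_sum, ← Finset.mul_sum, ← hS]
    have h2 : 0 ≤ 6 * M * 2 ^ a * stepSum α n ^ (-a) := by positivity
    have h3 : stepSum α n ^ (1 - a) / √(stepSum α n)
        = stepSum α n ^ (-a) * √(stepSum α n) := by
      rw [div_eq_iff hsq.ne', mul_assoc, Real.mul_self_sqrt hτ0.le, sub_eq_add_neg, add_comm,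
        Real.rpow_add hτ0, Real.rpow_one]
    rw [h3]
    have h4 := mul_le_mul_of_nonneg_left b3 h2
    refine (add_le_add le_rfl h4).trans (le_of_eq (by ring))
  have hsplit := Finset.sum_Ioc_consecutive
    (fun k => 2 * α k * ε k * (3 / √(1 + (stepSum α n - stepSum α k)))) (Nat.zero_le N) hn
  have hfn := hf n
  have hI : Finset.Icc 1 n = Finset.Ioc 0 n := rfl
  rw [hI, ← hsplit] at hfn
  set W := stepSum α n ^ (1 - a) with hW
  have hW0 : 0 ≤ W := Real.rpow_nonneg hτ0.le _
  have hfin : f n ≤ (3 * κ + D + 12 * M * S + 36 * M * 2 ^ a * W) / √(stepSum α n) := by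
    refine hfn.trans ((add_le_add b1 (add_le_add b2 b4)).trans (le_of_eq (by ring)))
  refine hfin.trans ?_
  rw [div_mul_eq_mul_div]
  refine div_le_div_of_nonneg_right ?_ hsq.le
  have hQ : 0 ≤ M * 2 ^ a := by positivity
  nlinarith [mul_nonneg hκ hS0, mul_nonneg hκ hW0, mul_nonneg hD0 hS0, mul_nonneg hD0 hW0,
    mul_nonneg hM.le hW0, mul_nonneg hQ hS0]

lemma rates_of_bound (hα : ∀ n : ℕ, 1 ≤ n → 0 ≤ α n ∧ α n ≤ 1) (hf0 : ∀ n, 0 ≤ f n)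
    (ha : 0 ≤ a) (hτ : Tendsto (stepSum α) atTop atTop)
    (h : ∃ C : ℝ, ∃ N : ℕ, 0 ≤ C ∧ ∀ n, N ≤ n → 1 ≤ stepSum α n ∧
      f n ≤ C / √(stepSum α n) * (1 + ∑ k ∈ Finset.Ioc N n,
        α k * (1 - α k) * stepSum α k ^ (-a) + stepSum α n ^ (1 - a))) :
    (a < 1 → f =O[atTop] (fun n => 1 / stepSum α n ^ (a - 1 / 2))) ∧
    (a = 1 → f =O[atTop] (fun n => Real.log (stepSum α n) / √(stepSum α n))) ∧
    (1 < a → f =O[atTop] (fun n => 1 / √(stepSum α n))) := by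
  obtain ⟨C, N, hC, h⟩ := h
  have hm := stepSum_mono hα
  have hsum : ∀ G : ℝ → ℝ, (∀ s t, 0 < s → s ≤ t → (t - s) * t ^ (-a) ≤ G t - G s) →
      ∀ n, N ≤ n → f n ≤ C / √(stepSum α n) *
        (1 + (G (stepSum α n) - G (stepSum α N)) + stepSum α n ^ (1 - a)) := by
    intro G hG n hn
    refine (h n hn).2.trans (mul_le_mul_of_nonneg_left ?_ (by positivity))
    have := sum_Ioc_le_sub (u := fun k => α k * (1 - α k) * stepSum α k ^ (-a))
      (G := fun k => G (stepSum α k)) hn (by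
        intro k hk _
        have := hG _ _ (by linarith [(h k hk).1]) (hm (Nat.le_succ k))
        rwa [Nat.succ_eq_add_one, stepSum_succ, add_sub_cancel_left, ← stepSum_succ] at this)
    linarith
  refine ⟨fun h1 => ?_, fun h1 => ?_, fun h1 => ?_⟩
  · have hb : 0 < 1 - a := by linarith
    refine IsBigO.of_bound (C * (2 + 1 / (1 - a))) ?_
    filter_upwards [eventually_ge_atTop N] with n hn
    have hf := hsum (fun t => t ^ (1 - a) / (1 - a))
      (fun s t hs hst => sub_mul_rpow_neg_le_of_lt_one ha h1 hs hst) n hn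
    have hτ1 := (h n hn).1
    have hτ0 : 0 < stepSum α n := by linarith
    have hN0 : 0 ≤ stepSum α N ^ (1 - a) / (1 - a) :=
      div_nonneg (Real.rpow_nonneg (by linarith [(h N le_rfl).1]) _) hb.le
    have hW : 1 ≤ stepSum α n ^ (1 - a) := Real.one_le_rpow hτ1 hb.le
    have e : 1 / stepSum α n ^ (a - 1 / 2) = stepSum α n ^ (1 - a) / √(stepSum α n) := by
      rw [Real.sqrt_eq_rpow, ← Real.rpow_sub hτ0, one_div, ← Real.rpow_neg hτ0.le]
      congr 1; ring
    rw [Real.norm_of_nonneg (hf0 n), Real.norm_of_nonneg (by positivity), e]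
    refine hf.trans ?_
    have : 1 + (stepSum α n ^ (1 - a) / (1 - a) - stepSum α N ^ (1 - a) / (1 - a))
        + stepSum α n ^ (1 - a) ≤ (2 + 1 / (1 - a)) * stepSum α n ^ (1 - a) := by
      have : (2 + 1 / (1 - a)) * stepSum α n ^ (1 - a)
        = 2 * stepSum α n ^ (1 - a) + stepSum α n ^ (1 - a) / (1 - a) := by ring
      linarith
    refine (mul_le_mul_of_nonneg_left this (by positivity)).trans (le_of_eq (by ring))
  · subst h1
    refine IsBigO.of_bound (C * 3) ?_
    -- The threshold `exp 1` makes the logarithm at least 1, so that it absorbs the constant terms.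
    filter_upwards [eventually_ge_atTop N, hτ.eventually_ge_atTop (Real.exp 1)] with n hn hn2
    have hf := hsum Real.log (fun s t hs hst => sub_mul_rpow_neg_one_le hs hst) n hn
    have hτ1 := (h n hn).1
    have hτ0 : 0 < stepSum α n := by linarith
    have hN0 : 0 ≤ Real.log (stepSum α N) := Real.log_nonneg (h N le_rfl).1
    have hL : 1 ≤ Real.log (stepSum α n) := by
      rwa [Real.le_log_iff_exp_le hτ0]
    rw [sub_self, Real.rpow_zero] at hf
    rw [Real.norm_of_nonneg (hf0 n), Real.norm_of_nonneg (by positivity)]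
    refine hf.trans ?_
    have : 1 + (Real.log (stepSum α n) - Real.log (stepSum α N)) + 1
        ≤ 3 * Real.log (stepSum α n) := by linarith
    refine (mul_le_mul_of_nonneg_left this (by positivity)).trans (le_of_eq (by ring))
  · have hb : 0 < a - 1 := by linarith
    refine IsBigO.of_bound (C * (2 + 1 / (a - 1))) ?_
    filter_upwards [eventually_ge_atTop N] with n hn
    have hf := hsum (fun t => -(t ^ (1 - a) / (a - 1)))
      (fun s t hs hst => (sub_mul_rpow_neg_le_of_one_lt h1 hs hst).trans (by linarith)) n hn
    have hτ1 := (h n hn).1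
    have hτ0 : 0 < stepSum α n := by linarith
    have hN1 : stepSum α N ^ (1 - a) / (a - 1) ≤ 1 / (a - 1) :=
      div_le_div_of_nonneg_right
        (Real.rpow_le_one_of_one_le_of_nonpos (h N le_rfl).1 (by linarith)) hb.le
    have hn0 : 0 ≤ stepSum α n ^ (1 - a) / (a - 1) :=
      div_nonneg (Real.rpow_nonneg hτ0.le _) hb.le
    have hW : stepSum α n ^ (1 - a) ≤ 1 :=
      Real.rpow_le_one_of_one_le_of_nonpos hτ1 (by linarith)
    rw [Real.norm_of_nonneg (hf0 n), Real.norm_of_nonneg (by positivity)]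
    refine hf.trans ?_
    have : 1 + (-(stepSum α n ^ (1 - a) / (a - 1)) - -(stepSum α N ^ (1 - a) / (a - 1)))
        + stepSum α n ^ (1 - a) ≤ 2 + 1 / (a - 1) := by linarith
    refine (mul_le_mul_of_nonneg_left this (by positivity)).trans (le_of_eq (by ring))

end Rates

/-! ### Rates in the clock, and transfer to a comparable clock. -/

section Main

variable {X : Type*} [NormedAddCommGroup X] [NormedSpace ℝ X]

theorem rates_of_tendsto_stepSum {C : Set X} {T : X → X} (hT : LipschitzOnWith 1 T C)
    {α : ℕ → ℝ} (hα : ∀ n : ℕ, 1 ≤ n → 0 ≤ α n ∧ α n ≤ 1) {e x : ℕ → X}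
    (hx : IsInexactKM T α e x) (h0 : StaysInWithBoundedImages C T x) {a : ℝ} (ha : 0 ≤ a)
    (hτ : Tendsto (stepSum α) atTop atTop)
    (he : (fun n => ‖e n‖) =O[atTop] (fun n => (1 - α n) / stepSum α n ^ a)) :
    (a < 1 → (fun n => ‖x n - T (x n)‖) =O[atTop] (fun n => 1 / stepSum α n ^ (a - 1 / 2))) ∧
    (a = 1 → (fun n => ‖x n - T (x n)‖) =O[atTop]
      (fun n => Real.log (stepSum α n) / √(stepSum α n))) ∧
    (1 < a → (fun n => ‖x n - T (x n)‖) =O[atTop] (fun n => 1 / √(stepSum α n))) := by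
  obtain ⟨κ, hκ, hC⟩ := h0
  exact rates_of_bound hα (fun n => norm_nonneg _) ha hτ
    (exists_bound_of_isBigO hα hκ (fun n => norm_nonneg (e n)) ha
      (norm_sub_map_le hT hα hx hκ hC) hτ he)

/-- The upper bound on `stepSum` converts the error hypothesis and the logarithm, the lower bound
converts the rates, and `δ` pays for the factor `1 - α n`. -/
theorem rates_of_stepSum_comparable {C : Set X} {T : X → X} (hT : LipschitzOnWith 1 T C)
    {α : ℕ → ℝ} (hα : ∀ n : ℕ, 1 ≤ n → 0 ≤ α n ∧ α n ≤ 1) {e x : ℕ → X}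
    (hx : IsInexactKM T α e x) (h0 : StaysInWithBoundedImages C T x) {a : ℝ} (ha : 1 / 2 ≤ a)
    {t : ℕ → ℝ} (ht : Tendsto t atTop atTop) {c : ℝ} (hc : 0 < c)
    (hct : ∀ᶠ n in atTop, c * t n ≤ stepSum α n) (htc : ∀ᶠ n in atTop, stepSum α n ≤ t n)
    {δ : ℝ} (hδ : 0 < δ) (hαδ : ∀ᶠ n in atTop, α n ≤ 1 - δ)
    (he : (fun n => ‖e n‖) =O[atTop] (fun n => 1 / t n ^ a)) :
    (a < 1 → (fun n => ‖x n - T (x n)‖) =O[atTop] (fun n => 1 / t n ^ (a - 1 / 2))) ∧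
    (a = 1 → (fun n => ‖x n - T (x n)‖) =O[atTop] (fun n => Real.log (t n) / √(t n))) ∧
    (1 < a → (fun n => ‖x n - T (x n)‖) =O[atTop] (fun n => 1 / √(t n))) := by
  have hτ : Tendsto (stepSum α) atTop atTop :=
    tendsto_atTop_mono' _ hct (ht.const_mul_atTop hc)
  have hpow : ∀ b : ℝ, 0 ≤ b → (fun n => 1 / stepSum α n ^ b) =O[atTop] fun n => 1 / t n ^ b := by
    intro b hb
    refine IsBigO.of_bound (1 / c ^ b) ?_
    filter_upwards [hct, htc, ht.eventually_ge_atTop 1] with n h1 h2 h3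
    have h4 : 0 < t n := by linarith
    have h5 : 0 < c * t n := mul_pos hc h4
    have h6 : 0 < stepSum α n := h5.trans_le h1
    rw [Real.norm_of_nonneg (by positivity), Real.norm_of_nonneg (by positivity),
      one_div_mul_one_div, ← Real.mul_rpow hc.le h4.le]
    exact one_div_le_one_div_of_le (by positivity) (Real.rpow_le_rpow h5.le h1 hb)
  have hsqrt : (fun n => 1 / √(stepSum α n)) =O[atTop] fun n => 1 / √(t n) := by
    simpa only [Real.sqrt_eq_rpow] using hpow (1 / 2) (by norm_num)
  have he' : (fun n => ‖e n‖) =O[atTop] (fun n => (1 - α n) / stepSum α n ^ a) := by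
    refine he.trans (IsBigO.of_bound (1 / δ) ?_)
    filter_upwards [htc, hαδ, ht.eventually_ge_atTop 1, hτ.eventually_ge_atTop 1]
      with n h1 h2 h3 h4
    have h5 : 0 < t n := by linarith
    have h6 : 0 < stepSum α n := by linarith
    have h7 : δ ≤ 1 - α n := by linarith
    have h8 : 0 ≤ 1 - α n := by linarith
    rw [Real.norm_of_nonneg (by positivity), Real.norm_of_nonneg (by positivity)]
    have h9 : 1 / t n ^ a ≤ 1 / stepSum α n ^ a :=
      one_div_le_one_div_of_le (by positivity) (Real.rpow_le_rpow h6.le h1 (by linarith))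
    refine h9.trans ?_
    rw [div_mul_div_comm, one_mul, div_le_div_iff₀ (by positivity) (by positivity), one_mul]
    exact mul_le_mul_of_nonneg_right h7 (by positivity)
  obtain ⟨r1, r2, r3⟩ := rates_of_tendsto_stepSum hT hα hx h0 (by linarith) hτ he'
  refine ⟨fun h => (r1 h).trans (hpow _ (by linarith)), fun h => (r2 h).trans ?_,
    fun h => (r3 h).trans hsqrt⟩
  have hlog : (fun n => Real.log (stepSum α n)) =O[atTop] fun n => Real.log (t n) := by
    refine IsBigO.of_bound 1 ?_
    filter_upwards [htc, hτ.eventually_ge_atTop 1] with n h1 h2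
    rw [one_mul, Real.norm_of_nonneg (Real.log_nonneg h2),
      Real.norm_of_nonneg (Real.log_nonneg (h2.trans h1))]
    exact Real.log_le_log (by linarith) h1
  simpa only [mul_one_div] using hlog.mul hsqrt

end Main

/-! ### The clocks of the two special rules, and the theorem. -/

lemma mul_le_stepSum {α : ℕ → ℝ} {δ : ℝ} (hδ : 0 < δ)
    (h : ∀ n : ℕ, 1 ≤ n → δ ≤ α n ∧ α n ≤ 1 - δ) (n : ℕ) : δ * δ * n ≤ stepSum α n := by
  induction n with
  | zero => simp [stepSum_zero]
  | succ n ih =>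
    obtain ⟨h1, h2⟩ := h (n + 1) (by omega)
    have : δ * δ ≤ α (n + 1) * (1 - α (n + 1)) :=
      mul_le_mul h1 (by linarith) hδ.le (by linarith)
    rw [stepSum_succ]
    push_cast
    linarith

lemma stepSum_le_natCast (α : ℕ → ℝ) (n : ℕ) : stepSum α n ≤ n := by
  induction n with
  | zero => simp [stepSum_zero]
  | succ n ih =>
    rw [stepSum_succ]
    push_cast
    nlinarith [sq_nonneg (α (n + 1) - 1 / 2)]

lemma stepSum_le_log {α : ℕ → ℝ} (h : ∀ n : ℕ, 1 ≤ n → α n = 1 / (n : ℝ)) {n : ℕ} (hn : 1 ≤ n) :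
    stepSum α n ≤ Real.log n := by
  induction n, hn using Nat.le_induction with
  | base => simp [stepSum, h]
  | succ n hn ih =>
    have hn0 : (0 : ℝ) < n := by exact_mod_cast hn
    have hl := Real.one_sub_inv_le_log_of_pos (x := ((n + 1 : ℕ) : ℝ) / n) (by positivity)
    rw [Real.log_div (by positivity) hn0.ne', inv_div] at hl
    rw [stepSum_succ, h _ (by omega)]
    have e : 1 - (n : ℝ) / ((n + 1 : ℕ) : ℝ) = 1 / ((n + 1 : ℕ) : ℝ) := by
      push_cast; field_simp; ring
    have e2 : 1 / ((n + 1 : ℕ) : ℝ) * (1 - 1 / ((n + 1 : ℕ) : ℝ)) ≤ 1 / ((n + 1 : ℕ) : ℝ) := by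
      have : (0 : ℝ) ≤ 1 / ((n + 1 : ℕ) : ℝ) := by positivity
      nlinarith
    linarith

lemma log_le_stepSum {α : ℕ → ℝ} (h : ∀ n : ℕ, 1 ≤ n → α n = 1 / (n : ℝ)) {n : ℕ} (hn : 1 ≤ n) :
    1 / 4 * Real.log n ≤ stepSum α n := by
  induction n, hn using Nat.le_induction with
  | base => simp [stepSum, h]
  | succ n hn ih =>
    have hn0 : (1 : ℝ) ≤ n := by exact_mod_cast hn
    have hl := Real.log_le_sub_one_of_pos (x := ((n + 1 : ℕ) : ℝ) / n) (by positivity)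
    rw [Real.log_div (by positivity) (by positivity)] at hl
    rw [stepSum_succ, h _ (by omega)]
    -- The constant `1/4` comes from `n + 1 ≤ 2n`, that is, `n / (n + 1)² ≥ 1 / (4n)`.
    have e : 1 / 4 * (((n + 1 : ℕ) : ℝ) / n - 1)
        ≤ 1 / ((n + 1 : ℕ) : ℝ) * (1 - 1 / ((n + 1 : ℕ) : ℝ)) := by
      have e1 : ((n + 1 : ℕ) : ℝ) / n - 1 = 1 / n := by push_cast; field_simp; ring
      have e2 : 1 / ((n + 1 : ℕ) : ℝ) * (1 - 1 / ((n + 1 : ℕ) : ℝ))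
          = n / ((n : ℝ) + 1) ^ 2 := by push_cast; field_simp; ring
      rw [e1, e2, div_mul_div_comm, div_le_div_iff₀ (by positivity) (by positivity)]
      nlinarith
    linarith

theorem theorem3 {X : Type*} [NormedAddCommGroup X] [NormedSpace ℝ X]
    (C : Set X) (hC_closed : IsClosed C) (hC_convex : Convex ℝ C)
    (T : X → X) (hT_maps : Set.MapsTo T C C) (hT_nonexp : LipschitzOnWith 1 T C)
    (α : ℕ → ℝ) (hα : ∀ n : ℕ, 1 ≤ n → 0 ≤ α n ∧ α n ≤ 1)
    (e x : ℕ → X) (hx : IsInexactKM T α e x) (h0 : StaysInWithBoundedImages C T x)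
    (a : ℝ) :
    -- general step sizes
    (Tendsto (stepSum α) atTop atTop →
      (fun n => ‖e n‖) =O[atTop] (fun n => (1 - α n) / stepSum α n ^ a) →
      ((1 / 2 ≤ a → a < 1 →
          (fun n => ‖x n - T (x n)‖) =O[atTop] (fun n => 1 / stepSum α n ^ (a - 1 / 2))) ∧
        (a = 1 →
          (fun n => ‖x n - T (x n)‖) =O[atTop]
            (fun n => Real.log (stepSum α n) / Real.sqrt (stepSum α n))) ∧
        (1 < a →
          (fun n => ‖x n - T (x n)‖) =O[atTop] (fun n => 1 / Real.sqrt (stepSum α n))))) ∧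
    -- step sizes bounded away from 0 and 1
    ((∃ δ : ℝ, 0 < δ ∧ ∀ n : ℕ, 1 ≤ n → δ ≤ α n ∧ α n ≤ 1 - δ) →
      (fun n => ‖e n‖) =O[atTop] (fun n : ℕ => 1 / (n : ℝ) ^ a) →
      ((1 / 2 ≤ a → a < 1 →
          (fun n => ‖x n - T (x n)‖) =O[atTop] (fun n : ℕ => 1 / (n : ℝ) ^ (a - 1 / 2))) ∧
        (a = 1 →
          (fun n => ‖x n - T (x n)‖) =O[atTop]
            (fun n : ℕ => Real.log (n : ℝ) / Real.sqrt (n : ℝ))) ∧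
        (1 < a →
          (fun n => ‖x n - T (x n)‖) =O[atTop] (fun n : ℕ => 1 / Real.sqrt (n : ℝ))))) ∧
    -- step sizes 1 / n
    ((∀ n : ℕ, 1 ≤ n → α n = 1 / (n : ℝ)) →
      (fun n => ‖e n‖) =O[atTop] (fun n : ℕ => 1 / Real.log (n : ℝ) ^ a) →
      ((1 / 2 ≤ a → a < 1 →
          (fun n => ‖x n - T (x n)‖) =O[atTop]
            (fun n : ℕ => 1 / Real.log (n : ℝ) ^ (a - 1 / 2))) ∧
        (a = 1 →
          (fun n => ‖x n - T (x n)‖) =O[atTop]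
            (fun n : ℕ => Real.log (Real.log (n : ℝ)) / Real.sqrt (Real.log (n : ℝ)))) ∧
        (1 < a →
          (fun n => ‖x n - T (x n)‖) =O[atTop]
            (fun n : ℕ => 1 / Real.sqrt (Real.log (n : ℝ)))))) := by
  refine ⟨fun hτ he => ?_, ?_, fun h he => ?_⟩
  · exact ⟨fun h1 => (rates_of_tendsto_stepSum hT_nonexp hα hx h0 (by linarith) hτ he).1,
      fun h1 => (rates_of_tendsto_stepSum hT_nonexp hα hx h0 (by linarith) hτ he).2.1 h1,
      fun h1 => (rates_of_tendsto_stepSum hT_nonexp hα hx h0 (by linarith) hτ he).2.2 h1⟩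
  · rintro ⟨δ, hδ, h⟩ he
    have key := fun ha : 1 / 2 ≤ a => rates_of_stepSum_comparable hT_nonexp hα hx h0 ha
      tendsto_natCast_atTop_atTop (mul_pos hδ hδ)
      (Eventually.of_forall (mul_le_stepSum hδ h))
      (Eventually.of_forall (stepSum_le_natCast α)) hδ
      ((eventually_ge_atTop 1).mono fun n hn => (h n hn).2) he
    exact ⟨fun h1 => (key h1).1, fun h1 => (key (by linarith)).2.1 h1,
      fun h1 => (key (by linarith)).2.2 h1⟩
  -- Only eventually, because `α 1 = 1`.
  · have hαδ : ∀ᶠ n in atTop, α n ≤ 1 - 1 / 2 := by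
      filter_upwards [eventually_ge_atTop 2] with n hn
      rw [h n (by omega)]
      have hn' : (2 : ℝ) ≤ n := by exact_mod_cast hn
      linarith [one_div_le_one_div_of_le zero_lt_two hn']
    have key := fun ha : 1 / 2 ≤ a => rates_of_stepSum_comparable hT_nonexp hα hx h0 ha
      (Real.tendsto_log_atTop.comp tendsto_natCast_atTop_atTop) (by norm_num : (0 : ℝ) < 1 / 4)
      ((eventually_ge_atTop 1).mono fun n hn => log_le_stepSum h hn)
      ((eventually_ge_atTop 1).mono fun n hn => stepSum_le_log h hn) one_half_pos hαδ he
    exact ⟨fun h1 => (key h1).1, fun h1 => (key (by linarith)).2.1 h1,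
      fun h1 => (key (by linarith)).2.2 h1⟩
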